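/- Let $T$ be a (possibly unbounded) self-adjoint operator in a separable complex Hilbert space $H$, with domain $\mathfrak D_T$, and let $E_x$ ($x\in\mathbb R$) be its (right-continuous) resolution of the identity, so that $T=\int_{\mathbb R}x\,dE_x$. Let $G\subseteq H$ be a generating subspace of $T$, i.e. the closed linear span of $\{E_\Delta g: g\in G,\ \Delta\subset\mathbb R \text{ an interval}\}$ is $H$. Let $\mathfrak N$ be a complex Hilbert space and $\psi:H\to\mathfrak N$ a bounded linear operator such that $\operatorname{Ker}\psi=H\ominus G$ and $\psi^*$ is invertible on $\mathfrak N$ (it suffices that $\psi^*$ is injective). Put $F(x)=\psi E_x\psi^*$. Let $L^2_{\mathbb R}(\mathfrak N,dF)$ be the Hilbert space obtained from the continuous compactly supported functions $f:\mathbb R\to\mathfrak N$ with values in a finite-dimensional subspace (depending on $f$) by completion with respect to the semi-inner product $\langle f,g\rangle=\int_{\mathbb R}\langle dF(x)f(x),g(x)\rangle_{\mathfrak N}$ (Riemann–Stieltjes integral) and factorization by the vectors of norm zero. Let $Q$ be the operator of multiplication by the independent variable in $L^2_{\mathbb R}(\mathfrak N,dF)$, $(Qf)(x)=xf(x)$,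 with domain $$\mathfrak D_Q=\{f\in L^2_{\mathbb R}(\mathfrak N,dF): xf(x)\in L^2_{\mathbb R}(\mathfrak N,dF)\},$$ where, for elements $f,h$ of the completion, $h(x)=xf(x)$ means that $\int\langle dF(x)h(x),g(x)\rangle=\int\langle dF(x)f(x),xg(x)\rangle$ for every $g$ in the above class of functions. Then there is a unique bounded linear operator $V:L^2_{\mathbb R}(\mathfrak N,dF)\to H$ such that $$Vf=\int_{\mathbb R}dE_x\,\psi^*f(x)$$ (a norm-convergent Riemann–Stieltjes integral) for every $f$ in the above class of functions. This $V$ is a unitary isomorphism of $L^2_{\mathbb R}(\mathfrak N,dF)$ onto $H$, and $$VQ=TV,$$ including equality of domains: $f\in\mathfrak D_Q$ if and only if $Vf\in\mathfrak D_T$, and then $VQf=TVf$. -/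

import Mathlib

open Filter Topology Set

noncomputable section

namespace SpectralModel

/-! ### Stieltjes integrals with respect to operator-valued functions -/

/-- A finite tagged partition `pt 0 ≤ pt 1 ≤ … ≤ pt n` of a compact interval of the real line, with
a tag `tag k` in each of the cells `[pt k, pt (k+1)]`, `k < n` (the values of `pt` and `tag` at
larger indices are irrelevant). -/
structure TaggedPartition where
  n : ℕ
  pt : ℕ → ℝ
  tag : ℕ → ℝ
  tag_mem : ∀ k < n, tag k ∈ Icc (pt k) (pt (k + 1))

/-- All cells have length `< ε` and the partitioned interval contains `[-1/ε, 1/ε]`. -/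
def TaggedPartition.IsFine (P : TaggedPartition) (ε : ℝ) : Prop :=
  P.pt 0 < -ε⁻¹ ∧ ε⁻¹ < P.pt P.n ∧ ∀ k < P.n, P.pt (k + 1) - P.pt k < ε

/-- The filter on tagged partitions along which the mesh tends to zero while the partitioned
interval exhausts the real line. -/
def refining : Filter TaggedPartition :=
  ⨅ ε : {ε : ℝ // 0 < ε}, 𝓟 {P | P.IsFine ε}

theorem TaggedPartition.IsFine.mono {P : TaggedPartition} {ε δ : ℝ} (hε : 0 < ε) (h : ε ≤ δ)
    (hP : P.IsFine ε) : P.IsFine δ := by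
  have h1 : δ⁻¹ ≤ ε⁻¹ := inv_anti₀ hε h
  refine ⟨by linarith [hP.1], by linarith [hP.2.1], fun k hk => ?_⟩
  linarith [hP.2.2 k hk]

theorem hasBasis_refining :
    refining.HasBasis (fun _ : {ε : ℝ // 0 < ε} => True) (fun ε => {P | P.IsFine ε}) := by
  have : Nonempty {ε : ℝ // 0 < ε} := ⟨⟨1, one_pos⟩⟩
  refine hasBasis_iInf_principal ?_
  rintro ⟨a, ha⟩ ⟨b, hb⟩
  refine ⟨⟨min a b, lt_min ha hb⟩, fun P hP => ?_, fun P hP => ?_⟩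
  · exact TaggedPartition.IsFine.mono (lt_min ha hb) (min_le_left _ _) hP
  · exact TaggedPartition.IsFine.mono (lt_min ha hb) (min_le_right _ _) hP

theorem eventually_isFine {ε : ℝ} (hε : 0 < ε) : ∀ᶠ P in refining, P.IsFine ε :=
  hasBasis_refining.mem_iff.2 ⟨⟨ε, hε⟩, trivial, subset_rfl⟩

instance refining_neBot : refining.NeBot := by
  rw [hasBasis_refining.neBot_iff]
  rintro ⟨ε, hε⟩ -
  obtain ⟨N, hN⟩ := exists_nat_gt (ε⁻¹ * ε⁻¹ * 2)
  refine ⟨⟨2 * (N + 1), fun k => -(((N : ℝ) + 1) * (ε / 2)) + k * (ε / 2),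
    fun k => -(((N : ℝ) + 1) * (ε / 2)) + k * (ε / 2), fun k _ => ?_⟩, ?_, ?_, fun k _ => ?_⟩
  · refine ⟨le_rfl, ?_⟩
    push_cast
    nlinarith
  · have : ε⁻¹ < (N + 1) * (ε / 2) := by
      have h2 : ε⁻¹ * ε⁻¹ * 2 * (ε / 2) = ε⁻¹ := by field_simp
      nlinarith
    simp only [Nat.cast_zero, zero_mul, add_zero]
    linarith
  · have : ε⁻¹ < (N + 1) * (ε / 2) := by
      have h2 : ε⁻¹ * ε⁻¹ * 2 * (ε / 2) = ε⁻¹ := by field_simp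
      nlinarith
    push_cast
    linarith
  · push_cast
    linarith

/-- The Riemann–Stieltjes sum `∑ (E(x_{k+1}) - E(x_k)) u(ξ_k)`. -/
def stieltjesSum {X Y : Type*} [NormedAddCommGroup X] [InnerProductSpace ℂ X]
    [NormedAddCommGroup Y] [InnerProductSpace ℂ Y]
    (E : ℝ → X →L[ℂ] Y) (u : ℝ → X) (P : TaggedPartition) : Y :=
  ∑ k ∈ Finset.range P.n, (E (P.pt (k + 1)) - E (P.pt k)) (u (P.tag k))

/-- `y = ∫_ℝ dE_x u(x)`: the Riemann–Stieltjes sums converge in norm to `y` as the mesh tends to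
zero and the partitioned interval exhausts `ℝ`. -/
def HasStieltjesIntegral {X Y : Type*} [NormedAddCommGroup X] [InnerProductSpace ℂ X]
    [NormedAddCommGroup Y] [InnerProductSpace ℂ Y]
    (E : ℝ → X →L[ℂ] Y) (u : ℝ → X) (y : Y) : Prop :=
  Tendsto (stieltjesSum E u) refining (𝓝 y)

/-! ### Resolutions of the identity -/

/-- A resolution of the identity on a Hilbert space: a non-decreasing, strongly right-continuous
family of orthogonal projections `E_t`, `t ∈ ℝ`, tending strongly to `0` at `-∞` and to the
identity at `+∞`. -/
structure ResolutionOfIdentity (H : Type*) [NormedAddCommGroup H] [InnerProductSpace ℂ H]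
    [CompleteSpace H] where
  toFun : ℝ → H →L[ℂ] H
  isStarProjection : ∀ t, IsStarProjection (toFun t)
  comp_eq : ∀ s t, s ≤ t → toFun t ∘L toFun s = toFun s
  right_continuous : ∀ t v, ContinuousWithinAt (fun s => toFun s v) (Ici t) t
  tendsto_atBot : ∀ v, Tendsto (fun s => toFun s v) atBot (𝓝 0)
  tendsto_atTop : ∀ v, Tendsto (fun s => toFun s v) atTop (𝓝 v)

namespace ResolutionOfIdentity

variable {H : Type*} [NormedAddCommGroup H] [InnerProductSpace ℂ H] [CompleteSpace H]

/-- `E` is the resolution of the identity of the (possibly unbounded) operator `T`, i.e.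
`T = ∫ x dE_x`: a vector `v` lies in the domain of `T` and `T v = w` if and only if the integral
`∫ x dE_x v` converges and equals `w`. -/
def IsResolutionOf (E : ResolutionOfIdentity H) (T : H →ₗ.[ℂ] H) : Prop :=
  ∀ v w : H, (v, w) ∈ T.graph ↔ HasStieltjesIntegral E.toFun (fun x => (x : ℂ) • v) w

/-- `G` is a generating subspace: the vectors `E_Δ g`, with `g ∈ G` and `Δ = (a, b]` an interval,
`E_Δ = E_b - E_a`, span a dense subspace of `H`. (The projections of the other kinds of intervals
are strong limits of these, so allowing them would not change the closed span.) -/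
def IsGenerating (E : ResolutionOfIdentity H) (G : Submodule ℂ H) : Prop :=
  (Submodule.span ℂ {v : H | ∃ a b : ℝ, a ≤ b ∧ ∃ g ∈ G,
    v = (E.toFun b - E.toFun a) g}).topologicalClosure = ⊤

end ResolutionOfIdentity

/-! ### Non-decreasing operator-valued functions -/

/-- A non-negative, non-decreasing, strongly right-continuous function on `ℝ` whose values are
bounded operators on `N`. -/
structure OperatorDistribution (N : Type*) [NormedAddCommGroup N] [InnerProductSpace ℂ N] where
  toFun : ℝ → N →L[ℂ] N
  isPositive : ∀ t, (toFun t).IsPositive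
  mono : ∀ s t, s ≤ t → (toFun t - toFun s).IsPositive
  right_continuous : ∀ t a, ContinuousWithinAt (fun s => toFun s a) (Ici t) t

theorem ResolutionOfIdentity.isStarProjection_sub {H : Type*} [NormedAddCommGroup H]
    [InnerProductSpace ℂ H] [CompleteSpace H] (E : ResolutionOfIdentity H) {s t : ℝ} (h : s ≤ t) :
    IsStarProjection (E.toFun t - E.toFun s) := by
  have h1 : E.toFun t * E.toFun s = E.toFun s := E.comp_eq s t h
  have h2 : E.toFun s * E.toFun t = E.toFun s := by
    have := congrArg star h1
    rwa [star_mul, (E.isStarProjection s).isSelfAdjoint.star_eq,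
      (E.isStarProjection t).isSelfAdjoint.star_eq] at this
  refine ⟨?_, (E.isStarProjection t).isSelfAdjoint.sub (E.isStarProjection s).isSelfAdjoint⟩
  change (E.toFun t - E.toFun s) * (E.toFun t - E.toFun s) = E.toFun t - E.toFun s
  have h3 : E.toFun t * E.toFun t = E.toFun t := (E.isStarProjection t).isIdempotentElem
  have h4 : E.toFun s * E.toFun s = E.toFun s := (E.isStarProjection s).isIdempotentElem
  rw [mul_sub, sub_mul, sub_mul, h1, h2, h3, h4]
  abel

/-- The function `F(x) = ψ E_x ψ*`. -/
def ResolutionOfIdentity.compress {H N : Type*} [NormedAddCommGroup H] [InnerProductSpace ℂ H]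
    [CompleteSpace H] [NormedAddCommGroup N] [InnerProductSpace ℂ N] [CompleteSpace N]
    (E : ResolutionOfIdentity H) (ψ : H →L[ℂ] N) : OperatorDistribution N where
  toFun x := ψ ∘L E.toFun x ∘L ContinuousLinearMap.adjoint ψ
  isPositive t :=
    (ContinuousLinearMap.IsPositive.of_isStarProjection (E.isStarProjection t)).conj_adjoint ψ
  mono s t h := by
    have := (ContinuousLinearMap.IsPositive.of_isStarProjection
      (E.isStarProjection_sub h)).conj_adjoint ψ
    convert this using 1
    ext a
    simp
  right_continuous t a :=
    ψ.continuous.continuousAt.comp_continuousWithinAt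
      (E.right_continuous t (ContinuousLinearMap.adjoint ψ a))

/-! ### The space `L²_ℝ(N, dF)` -/

section Space

variable {N : Type*} [NormedAddCommGroup N] [InnerProductSpace ℂ N]

variable (N) in
/-- The continuous compactly supported functions `ℝ → N` whose values lie in a finite-dimensional
subspace (depending on the function; no restriction if `N` is finite-dimensional). For
infinite-dimensional `N` this is the standard class on which `∫ ⟪f(x), dF(x) g(x)⟫` always exists
as a Riemann–Stieltjes integral. -/
def simpleCc : Submodule ℂ (ℝ → N) where
  carrier := {f | Continuous f ∧ HasCompactSupport f ∧
    ∃ W : Submodule ℂ N, FiniteDimensional ℂ W ∧ ∀ x, f x ∈ W}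
  zero_mem' := ⟨continuous_zero, HasCompactSupport.zero, ⊥, inferInstance, fun _ => by simp⟩
  add_mem' := by
    rintro f g ⟨hf, hf', W, hW, hfW⟩ ⟨hg, hg', W', hW', hgW⟩
    exact ⟨hf.add hg, hf'.add hg', W ⊔ W', inferInstance, fun x =>
      Submodule.add_mem_sup (hfW x) (hgW x)⟩
  smul_mem' := by
    rintro c f ⟨hf, hf', W, hW, hfW⟩
    refine ⟨hf.const_smul c, ?_, W, hW, fun x => W.smul_mem c (hfW x)⟩
    exact hf'.smul_left (f := fun _ => c)

/-- The Riemann–Stieltjes sum `∑ ⟪f(ξ_k), (F(x_{k+1}) - F(x_k)) g(ξ_k)⟫` for the sesquilinear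
form `∫ ⟪f(x), dF(x) g(x)⟫`. -/
def formSum (F : ℝ → N →L[ℂ] N) (f g : ℝ → N) (P : TaggedPartition) : ℂ :=
  ∑ k ∈ Finset.range P.n,
    inner ℂ (f (P.tag k)) ((F (P.pt (k + 1)) - F (P.pt k)) (g (P.tag k)))

/-- The sesquilinear form `∫ ⟪f(x), dF(x) g(x)⟫`, conjugate-linear in `f` and linear in `g`. -/
def form (F : ℝ → N →L[ℂ] N) (f g : ℝ → N) : ℂ :=
  limUnder refining (formSum F f g)

/-- The non-decreasing function `x ↦ ⟪a, F(x) a⟫`. -/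
def OperatorDistribution.scalar (F : OperatorDistribution N) (a : N) : StieltjesFunction ℝ where
  toFun x := (inner ℂ a (F.toFun x a)).re
  mono' s t h := by
    have := (F.mono s t h).re_inner_nonneg_right a
    simp only [sub_apply, inner_sub_right] at this
    simpa using this
  right_continuous' t := by
    have h := F.right_continuous t a
    exact Complex.continuous_re.continuousAt.comp_continuousWithinAt
      ((Continuous.inner continuous_const continuous_id).continuousAt.comp_continuousWithinAt h)

theorem tendsto_scalar_sum (α : StieltjesFunction ℝ) {φ : ℝ → ℂ} (hφ : Continuous φ)
    (hc : HasCompactSupport φ) :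
    Tendsto (fun P : TaggedPartition => ∑ k ∈ Finset.range P.n,
      φ (P.tag k) * ((α (P.pt (k + 1)) - α (P.pt k) : ℝ) : ℂ)) refining
      (𝓝 (∫ x, φ x ∂α.measure)) := by
  have hint : MeasureTheory.Integrable φ α.measure := hφ.integrable_of_hasCompactSupport hc
  obtain ⟨R, hR0, hR⟩ : ∃ R : ℝ, 0 < R ∧ ∀ x, φ x ≠ 0 → |x| ≤ R := by
    obtain ⟨R, hR0, hR⟩ := hc.isCompact.isBounded.exists_pos_norm_le
    exact ⟨R, hR0, fun x hx => hR x (subset_tsupport _ hx)⟩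
  have huc : UniformContinuous φ := hc.uniformContinuous_of_continuous hφ
  rw [Metric.tendsto_nhds]
  intro ε hε
  set C : ℝ := α.measure.real (Icc (-R - 1) (R + 1)) with hC
  have hC0 : 0 ≤ C := MeasureTheory.measureReal_nonneg
  set η : ℝ := ε / (C + 1) with hη
  have hη0 : 0 < η := by positivity
  obtain ⟨δ, hδ0, hδ⟩ := Metric.uniformContinuous_iff.1 huc η hη0
  have hpos : 0 < min δ (min 1 (R + 1)⁻¹) := by positivity
  filter_upwards [eventually_isFine hpos] with P hP
  obtain ⟨hP0, hPn, hPm⟩ := hP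
  have hinv : R + 1 ≤ (min δ (min 1 (R + 1)⁻¹))⁻¹ := by
    rw [le_inv_comm₀ (by positivity) hpos]
    exact (min_le_right _ _).trans (min_le_right _ _)
  have hcell : ∀ k < P.n, P.pt k ≤ P.pt (k + 1) := fun k hk =>
    (P.tag_mem k hk).1.trans (P.tag_mem k hk).2
  have hm1 : ∀ k < P.n, P.pt (k + 1) - P.pt k < δ := fun k hk =>
    (hPm k hk).trans_le (min_le_left _ _)
  have hm2 : ∀ k < P.n, P.pt (k + 1) - P.pt k < 1 := fun k hk =>
    (hPm k hk).trans_le ((min_le_right _ _).trans (min_le_left _ _))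
  have hends : P.pt 0 ≤ P.pt P.n := by linarith
  have h1 : ∫ x, φ x ∂α.measure
      = ∑ k ∈ Finset.range P.n, ∫ x in P.pt k..P.pt (k + 1), φ x ∂α.measure := by
    rw [intervalIntegral.sum_integral_adjacent_intervals (fun k _ => hint.intervalIntegrable),
      intervalIntegral.integral_of_le hends,
      MeasureTheory.setIntegral_eq_integral_of_forall_compl_eq_zero]
    intro x hx
    by_contra h0
    have := abs_le.1 (hR x h0)
    exact hx ⟨by linarith, by linarith⟩
  have h2 : ∀ k ∈ Finset.range P.n, φ (P.tag k) * ((α (P.pt (k + 1)) - α (P.pt k) : ℝ) : ℂ)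
      = ∫ _ in P.pt k..P.pt (k + 1), φ (P.tag k) ∂α.measure := by
    intro k hk
    have hk' := hcell k (Finset.mem_range.1 hk)
    rw [intervalIntegral.integral_of_le hk', MeasureTheory.setIntegral_const,
      MeasureTheory.measureReal_def, α.measure_Ioc,
      ENNReal.toReal_ofReal (sub_nonneg.2 (α.mono hk')), Complex.real_smul, mul_comm]
  let g : ℝ → ℝ := (Icc (-R - 1) (R + 1)).indicator fun _ => η
  have hgint : MeasureTheory.Integrable g α.measure :=
    (MeasureTheory.integrable_indicator_iff measurableSet_Icc).2
      (MeasureTheory.integrableOn_const isCompact_Icc.measure_lt_top.ne)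
  have hg0 : ∀ x, 0 ≤ g x := fun x => indicator_nonneg (fun _ _ => hη0.le) x
  have hgtot : ∫ x, g x ∂α.measure = C * η := by
    rw [MeasureTheory.integral_indicator measurableSet_Icc, MeasureTheory.setIntegral_const,
      smul_eq_mul]
  rw [dist_eq_norm, h1, Finset.sum_congr rfl h2, ← Finset.sum_sub_distrib]
  have h3 : ∀ k ∈ Finset.range P.n,
      ‖(∫ _ in P.pt k..P.pt (k + 1), φ (P.tag k) ∂α.measure)
        - ∫ x in P.pt k..P.pt (k + 1), φ x ∂α.measure‖
      ≤ ∫ x in P.pt k..P.pt (k + 1), g x ∂α.measure := by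
    intro k hk
    have hk := Finset.mem_range.1 hk
    have htag := P.tag_mem k hk
    rw [← intervalIntegral.integral_sub intervalIntegrable_const hint.intervalIntegrable]
    refine intervalIntegral.norm_integral_le_of_norm_le (hcell k hk)
      (Eventually.of_forall fun x hx => ?_) hgint.intervalIntegrable
    have d1 := hm1 k hk
    have d2 := hm2 k hk
    by_cases hxI : x ∈ Icc (-R - 1) (R + 1)
    · simp only [g, indicator_of_mem hxI]
      rw [← dist_eq_norm]
      refine (hδ ?_).le
      rw [Real.dist_eq, abs_lt]
      constructor <;> linarith [hx.1, hx.2, htag.1, htag.2]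
    · have e1 : φ x = 0 := by
        by_contra h0
        have := abs_le.1 (hR x h0)
        exact hxI ⟨by linarith, by linarith⟩
      have e2 : φ (P.tag k) = 0 := by
        by_contra h0
        have := abs_le.1 (hR _ h0)
        exact hxI ⟨by linarith [hx.1, hx.2, htag.1, htag.2],
          by linarith [hx.1, hx.2, htag.1, htag.2]⟩
      rw [e1, e2, sub_zero, norm_zero]
      exact hg0 x
  calc ‖∑ k ∈ Finset.range P.n, ((∫ _ in P.pt k..P.pt (k + 1), φ (P.tag k) ∂α.measure)
        - ∫ x in P.pt k..P.pt (k + 1), φ x ∂α.measure)‖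
      ≤ ∑ k ∈ Finset.range P.n, ∫ x in P.pt k..P.pt (k + 1), g x ∂α.measure :=
        norm_sum_le_of_le _ h3
    _ = ∫ x in P.pt 0..P.pt P.n, g x ∂α.measure :=
        intervalIntegral.sum_integral_adjacent_intervals (fun k _ => hgint.intervalIntegrable)
    _ ≤ ∫ x, g x ∂α.measure := by
        rw [intervalIntegral.integral_of_le hends]
        exact MeasureTheory.setIntegral_le_integral hgint (Eventually.of_forall hg0)
    _ = C * η := hgtot
    _ < ε := by
        rw [hη, mul_div_assoc', div_lt_iff₀ (by positivity)]
        nlinarith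

/-- Convergence of `∑ φ(ξ_k) ⟪b, (F(x_{k+1}) - F(x_k)) a⟫`. -/
theorem OperatorDistribution.exists_tendsto_sum (F : OperatorDistribution N) {φ : ℝ → ℂ}
    (hφ : Continuous φ) (hc : HasCompactSupport φ) (a b : N) :
    ∃ z : ℂ, Tendsto (fun P : TaggedPartition => ∑ k ∈ Finset.range P.n,
      φ (P.tag k) * inner ℂ b ((F.toFun (P.pt (k + 1)) - F.toFun (P.pt k)) a)) refining (𝓝 z) := by
  have key : ∀ c : N, ∃ z : ℂ, Tendsto (fun P : TaggedPartition => ∑ k ∈ Finset.range P.n,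
      φ (P.tag k) * inner ℂ ((F.toFun (P.pt (k + 1)) - F.toFun (P.pt k)) c) c)
      refining (𝓝 z) := by
    intro c
    refine ⟨_, (tendsto_scalar_sum (F.scalar c) hφ hc).congr fun P => ?_⟩
    refine Finset.sum_congr rfl fun k hk => ?_
    have hk := P.tag_mem k (Finset.mem_range.1 hk)
    have hp := F.mono _ _ (hk.1.trans hk.2)
    have hz : inner ℂ c ((F.toFun (P.pt (k + 1)) - F.toFun (P.pt k)) c)
        = (((F.scalar c) (P.pt (k + 1)) - (F.scalar c) (P.pt k) : ℝ) : ℂ) := by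
      have h0 := Complex.le_def.1 (hp.inner_nonneg_right c)
      apply Complex.ext
      · simp [OperatorDistribution.scalar]
      · rw [Complex.ofReal_im]
        exact h0.2.symm
    rw [← hz, hp.inner_left_eq_inner_right]
  obtain ⟨z1, h1⟩ := key (b + a)
  obtain ⟨z2, h2⟩ := key (b - a)
  obtain ⟨z3, h3⟩ := key (b + Complex.I • a)
  obtain ⟨z4, h4⟩ := key (b - Complex.I • a)
  refine ⟨(z1 - z2 + Complex.I * z3 * (-1) + Complex.I * z4) / 4,
    ((((h1.sub h2).add ((h3.const_mul Complex.I).mul_const (-1))).add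
      (h4.const_mul Complex.I)).div_const 4).congr fun P => ?_⟩
  simp only [Finset.mul_sum, Finset.sum_mul, ← Finset.sum_sub_distrib, ← Finset.sum_add_distrib,
    Finset.sum_div]
  refine Finset.sum_congr rfl fun k hk => ?_
  have hk := P.tag_mem k (Finset.mem_range.1 hk)
  have hp := F.mono _ _ (hk.1.trans hk.2)
  rw [← hp.inner_left_eq_inner_right]
  have := inner_map_polarization'
    ((F.toFun (P.pt (k + 1)) - F.toFun (P.pt k) : N →L[ℂ] N) : N →ₗ[ℂ] N) b a
  simp only [ContinuousLinearMap.coe_coe] at this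
  rw [this]
  ring

theorem OperatorDistribution.tendsto_formSum (F : OperatorDistribution N) {f g : ℝ → N}
    (hf : f ∈ simpleCc N) (hg : g ∈ simpleCc N) :
    Tendsto (formSum F.toFun f g) refining (𝓝 (form F.toFun f g)) := by
  apply tendsto_nhds_limUnder
  obtain ⟨hfc, hfs, W, hW, hfW⟩ := hf
  obtain ⟨hgc, hgs, W', hW', hgW⟩ := hg
  let e := stdOrthonormalBasis ℂ W
  let e' := stdOrthonormalBasis ℂ W'
  have hfe : ∀ x, f x = ∑ i, inner ℂ (e i : N) (f x) • (e i : N) := fun x => by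
    have := congrArg (Subtype.val) (e.sum_repr' ⟨f x, hfW x⟩)
    simpa using this.symm
  have hge : ∀ x, g x = ∑ i, inner ℂ (e' i : N) (g x) • (e' i : N) := fun x => by
    have := congrArg (Subtype.val) (e'.sum_repr' ⟨g x, hgW x⟩)
    simpa using this.symm
  have hex : ∀ i j, ∃ z : ℂ, Tendsto (fun P : TaggedPartition => ∑ k ∈ Finset.range P.n,
      (inner ℂ (f (P.tag k)) (e i : N) * inner ℂ (e' j : N) (g (P.tag k))) *
        inner ℂ (e i : N) ((F.toFun (P.pt (k + 1)) - F.toFun (P.pt k)) (e' j : N)))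
      refining (𝓝 z) := by
    intro i j
    refine F.exists_tendsto_sum
      (φ := fun x => inner ℂ (f x) (e i : N) * inner ℂ (e' j : N) (g x)) ?_ ?_ _ _
    · fun_prop
    · refine hfs.mono fun x hx => ?_
      rw [Function.mem_support] at hx ⊢
      intro h0
      simp [h0] at hx
  choose z hz using hex
  refine ⟨∑ i, ∑ j, z i j, (tendsto_finsetSum _ fun i _ => tendsto_finsetSum _ fun j _ =>
    hz i j).congr fun P => ?_⟩
  have hk : ∀ k, inner ℂ (f (P.tag k)) ((F.toFun (P.pt (k + 1)) - F.toFun (P.pt k)) (g (P.tag k)))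
      = ∑ i, ∑ j, (inner ℂ (f (P.tag k)) (e i : N) * inner ℂ (e' j : N) (g (P.tag k))) *
        inner ℂ (e i : N) ((F.toFun (P.pt (k + 1)) - F.toFun (P.pt k)) (e' j : N)) := by
    intro k
    conv_lhs => rw [hfe (P.tag k), hge (P.tag k)]
    simp only [map_sum, map_smul, sum_inner, inner_sum, inner_smul_left, inner_smul_right,
      inner_conj_symm]
    rw [Finset.sum_comm]
    refine Finset.sum_congr rfl fun i _ => ?_
    rw [Finset.mul_sum]
    refine Finset.sum_congr rfl fun j _ => ?_
    ring
  simp only [formSum, hk]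
  symm
  rw [Finset.sum_comm]
  exact Finset.sum_congr rfl fun i _ => Finset.sum_comm

/-- The space `simpleCc N` equipped with the semi-inner product `∫ ⟪f(x), dF(x) g(x)⟫`. -/
def PreL2 (_F : OperatorDistribution N) : Type _ := simpleCc N

namespace PreL2

variable (F : OperatorDistribution N)

instance : AddCommGroup (PreL2 F) := inferInstanceAs (AddCommGroup (simpleCc N))

instance : Module ℂ (PreL2 F) := inferInstanceAs (Module ℂ (simpleCc N))

/-- The semi-inner product; conjugate-linear in the first argument. -/
@[reducible]
def core : PreInnerProductSpace.Core ℂ (PreL2 F) where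
  inner f g := form F.toFun f.1 g.1
  conj_inner_symm f g := by
    have h := (Complex.continuous_conj.tendsto _).comp (F.tendsto_formSum g.2 f.2)
    refine tendsto_nhds_unique (h.congr fun P => ?_) (F.tendsto_formSum f.2 g.2)
    simp only [Function.comp, formSum, map_sum]
    refine Finset.sum_congr rfl fun k hk => ?_
    have hk := P.tag_mem k (Finset.mem_range.1 hk)
    rw [inner_conj_symm, (F.mono _ _ (hk.1.trans hk.2)).inner_left_eq_inner_right]
  re_inner_nonneg f := by
    have h := (Complex.continuous_re.tendsto _).comp (F.tendsto_formSum f.2 f.2)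
    refine ge_of_tendsto' h fun P => ?_
    simp only [Function.comp, formSum, Complex.re_sum]
    refine Finset.sum_nonneg fun k hk => ?_
    have hk := P.tag_mem k (Finset.mem_range.1 hk)
    exact (F.mono _ _ (hk.1.trans hk.2)).re_inner_nonneg_right _
  add_left f g h := by
    refine tendsto_nhds_unique (F.tendsto_formSum (f + g).2 h.2)
      (((F.tendsto_formSum f.2 h.2).add (F.tendsto_formSum g.2 h.2)).congr fun P => ?_)
    simp only [formSum, ← Finset.sum_add_distrib, ← inner_add_left]
    rfl
  smul_left f g c := by
    refine tendsto_nhds_unique (F.tendsto_formSum (c • f).2 g.2)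
      (((F.tendsto_formSum f.2 g.2).const_mul _).congr fun P => ?_)
    simp only [formSum, Finset.mul_sum, ← inner_smul_left]
    rfl

instance : SeminormedAddCommGroup (PreL2 F) :=
  @InnerProductSpace.Core.toSeminormedAddCommGroup ℂ _ _ _ _ (core F)

instance : InnerProductSpace ℂ (PreL2 F) := InnerProductSpace.ofCore (core F)

end PreL2

/-- The Hilbert space `L²_ℝ(N, dF)`: the completion of `simpleCc N` with respect to the semi-inner
product `∫ ⟪f(x), dF(x) g(x)⟫`. (The completion is the Hausdorff one, i.e. functions at distance
zero are identified.) -/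
abbrev L2 (F : OperatorDistribution N) : Type _ := UniformSpace.Completion (PreL2 F)

/-- The class of a function in `L²_ℝ(N, dF)`. -/
def L2.mk (F : OperatorDistribution N) : simpleCc N →ₗ[ℂ] L2 F where
  toFun f := UniformSpace.Completion.coe' (α := PreL2 F) f
  map_add' f g := UniformSpace.Completion.coe_add (α := PreL2 F) f g
  map_smul' c f := UniformSpace.Completion.coe_smul (X := PreL2 F) c f

theorem L2.inner_mk (F : OperatorDistribution N) (f g : simpleCc N) :
    inner ℂ (L2.mk F f) (L2.mk F g) = form F.toFun f.1 g.1 :=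
  UniformSpace.Completion.inner_coe (𝕜 := ℂ) (E := PreL2 F) f g

theorem L2.denseRange_mk (F : OperatorDistribution N) : DenseRange (L2.mk F) :=
  UniformSpace.Completion.denseRange_coe (α := PreL2 F)

/-! ### Multiplication by the independent variable -/

/-- The function `x ↦ x f(x)`. -/
def mulVar (f : simpleCc N) : simpleCc N :=
  ⟨fun x => (x : ℂ) • f.1 x, by
    obtain ⟨hf, hf', W, hW, hfW⟩ := f.2
    exact ⟨Complex.continuous_ofReal.smul hf, hf'.smul_left (f := fun x : ℝ => (x : ℂ)), W, hW,
      fun x => W.smul_mem _ (hfW x)⟩⟩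

/-- `h(x) = x f(x)` in `L²_ℝ(N, dF)`: the products `h(x)` and `x f(x)` have the same integrals
`∫ ⟪g(x), dF(x) h(x)⟫ = ∫ ⟪g(x), dF(x) x f(x)⟫ = ∫ ⟪x g(x), dF(x) f(x)⟫` against all test
functions `g`. -/
def L2.IsMulVar (F : OperatorDistribution N) (f h : L2 F) : Prop :=
  ∀ g : simpleCc N, inner ℂ (L2.mk F g) h = inner ℂ (L2.mk F (mulVar g)) f

theorem L2.IsMulVar.unique {F : OperatorDistribution N} {f h h' : L2 F}
    (H : L2.IsMulVar F f h) (H' : L2.IsMulVar F f h') : h = h' := by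
  refine ext_inner_left ℂ fun v => ?_
  have h1 : Continuous fun v : L2 F => inner ℂ v h := by fun_prop
  have h2 : Continuous fun v : L2 F => inner ℂ v h' := by fun_prop
  exact congrFun ((L2.denseRange_mk F).equalizer h1 h2
    (funext fun g => (H g).trans (H' g).symm)) v

/-- On functions, the relation is honest multiplication by `x`. -/
theorem L2.isMulVar_mk (F : OperatorDistribution N) (f : simpleCc N) :
    L2.IsMulVar F (L2.mk F f) (L2.mk F (mulVar f)) := by
  intro g
  rw [L2.inner_mk, L2.inner_mk]
  refine tendsto_nhds_unique (F.tendsto_formSum g.2 (mulVar f).2)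
    ((F.tendsto_formSum (mulVar g).2 f.2).congr fun P => ?_)
  refine Finset.sum_congr rfl fun k _ => ?_
  simp [mulVar]

/-- The operator `Q` of multiplication by the independent variable in `L²_ℝ(N, dF)`, with its
maximal domain `{f : x f(x) ∈ L²_ℝ(N, dF)}`. -/
def mulOperator (F : OperatorDistribution N) : L2 F →ₗ.[ℂ] L2 F where
  domain :=
    { carrier := {f | ∃ h, L2.IsMulVar F f h}
      zero_mem' := ⟨0, fun g => by simp⟩
      add_mem' := by
        rintro f f' ⟨h, H⟩ ⟨h', H'⟩
        exact ⟨h + h', fun g => by rw [inner_add_right, inner_add_right, H g, H' g]⟩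
      smul_mem' := by
        rintro c f ⟨h, H⟩
        exact ⟨c • h, fun g => by rw [inner_smul_right, inner_smul_right, H g]⟩ }
  toFun :=
    { toFun := fun f => f.2.choose
      map_add' := fun f f' => L2.IsMulVar.unique (f + f').2.choose_spec fun g => by
        have h1 := f.2.choose_spec g
        have h2 := f'.2.choose_spec g
        rw [inner_add_right, h1, h2, ← inner_add_right]
        rfl
      map_smul' := fun c f => L2.IsMulVar.unique (c • f).2.choose_spec fun g => by
        have h1 := f.2.choose_spec g
        rw [RingHom.id_apply, inner_smul_right, h1, ← inner_smul_right]
        rfl }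

theorem mem_mulOperator_domain {F : OperatorDistribution N} {f : L2 F} :
    f ∈ (mulOperator F).domain ↔ ∃ h, L2.IsMulVar F f h := Iff.rfl

theorem isMulVar_mulOperator {F : OperatorDistribution N} (f : (mulOperator F).domain) :
    L2.IsMulVar F f (mulOperator F f) := f.2.choose_spec

end Space
end SpectralModel
end

open SpectralModel

noncomputable section

namespace SpectralModel

open MeasureTheory

/-! ### Projections and the spectral measure of a vector -/

namespace ResolutionOfIdentity

variable {H : Type*} [NormedAddCommGroup H] [InnerProductSpace ℂ H] [CompleteSpace H]
  (E : ResolutionOfIdentity H)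

/-! Increments of `E` over disjoint cells have orthogonal ranges, and over a single cell they are
projections. Hence for one and the same partition the inner product of two Riemann–Stieltjes sums `∑
E_Δ u(ξ)` and `∑ E_Δ v(ξ)` equals the diagonal sum `∑ ⟪u(ξ), E_Δ v(ξ)⟫` exactly
(`inner_stieltjesSum`). With `u = ψ* f` and `v = ψ* g` the limit says that `f ↦ ∫ dE ψ* f` preserves
the form defining `L²(N, dF)` (`inner_synthesis`), so it extends to an isometry `V`.

`V` is onto because the range on test functions is dense (`denseRange_synthesis`). Approximating the
indicator of `Δ` by continuous `φ` in `L²` of a scalar spectral measure puts every `E_Δ ψ* n` in the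
closure. The closure of `ran ψ*` is `(ker ψ)ᗮ`, which contains the generating subspace `G`.

For `VQ = TV`: `Q` is defined weakly, so it is the adjoint of multiplication by `x` on test
functions. Under `V` that multiplication becomes a restriction of `T` (`synthesis_mem_graph`), and
the restriction is to a core (`mem_closure_synthesis_graph`), because dividing by `x + i` preserves
test functions and `‖(T + i)v‖² = ‖Tv‖² + ‖v‖²`. The adjoint of the restriction is therefore `T* =
T`, domains included (`isMulVar_iff`).

Existence of the integrals rests on one estimate: `∫ dE φ w` for a step function `φ` has norm `‖φ‖`
in `L²` of the measure `d⟪w, E_t w⟫`, whose total mass is `‖w‖²`. -/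

theorem inner_left (t : ℝ) (v w : H) : inner ℂ (E.toFun t v) w = inner ℂ v (E.toFun t w) :=
  (ContinuousLinearMap.IsPositive.of_isStarProjection
    (E.isStarProjection t)).inner_left_eq_inner_right v w

theorem apply_apply (s t : ℝ) (v : H) : E.toFun s (E.toFun t v) = E.toFun (min s t) v := by
  rcases le_total t s with h | h
  · rw [min_eq_right h]
    exact DFunLike.congr_fun (E.comp_eq t s h) v
  · rw [min_eq_left h]
    have h1 := congrArg star (E.comp_eq s t h)
    rw [← ContinuousLinearMap.mul_def, star_mul, (E.isStarProjection s).isSelfAdjoint.star_eq,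
      (E.isStarProjection t).isSelfAdjoint.star_eq] at h1
    exact DFunLike.congr_fun h1 v

/-- The distribution function `t ↦ ⟪v, E_t v⟫`. -/
def distribution (v : H) : StieltjesFunction ℝ :=
  (E.compress (ContinuousLinearMap.id ℂ H)).scalar v

theorem distribution_apply (v : H) (t : ℝ) :
    E.distribution v t = (inner ℂ v (E.toFun t v)).re := by
  change (inner ℂ v (((ContinuousLinearMap.id ℂ H) ∘L E.toFun t ∘L
    ContinuousLinearMap.adjoint (ContinuousLinearMap.id ℂ H)) v)).re = _
  have h : ContinuousLinearMap.adjoint (ContinuousLinearMap.id ℂ H) = ContinuousLinearMap.id ℂ H :=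
    star_one (H →L[ℂ] H)
  rw [h]
  rfl

theorem ofReal_distribution (v : H) (t : ℝ) :
    (E.distribution v t : ℂ) = inner ℂ v (E.toFun t v) := by
  rw [distribution_apply]
  refine Complex.conj_eq_iff_re.1 ?_
  rw [inner_conj_symm, E.inner_left]

theorem measure_distribution_univ (v : H) :
    (E.distribution v).measure univ = ENNReal.ofReal (‖v‖ ^ 2) := by
  have h : ∀ w l, Tendsto (fun t => E.toFun t v) l (𝓝 w) →
      Tendsto (E.distribution v) l (𝓝 (inner ℂ v w).re) := by
    intro w l hl
    have h1 := (Complex.continuous_re.tendsto _).comp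
      ((tendsto_const_nhds (x := v)).inner (𝕜 := ℂ) hl)
    exact h1.congr fun t => (E.distribution_apply v t).symm
  rw [StieltjesFunction.measure_univ _ (h _ _ (E.tendsto_atBot v)) (h _ _ (E.tendsto_atTop v))]
  simp [inner_self_eq_norm_sq_to_K, ← Complex.ofReal_pow]

instance (v : H) : IsFiniteMeasure (E.distribution v).measure :=
  ⟨by rw [measure_distribution_univ]; exact ENNReal.ofReal_lt_top⟩

theorem measureReal_distribution_univ (v : H) :
    (E.distribution v).measure.real univ = ‖v‖ ^ 2 := by
  rw [measureReal_def, measure_distribution_univ, ENNReal.toReal_ofReal (by positivity)]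

/-- The product of the two increments is the increment over the intersection `(max a c, min b d]`.
The outer `max` covers an empty intersection, where the two terms on the right cancel. -/
theorem inner_increments {a b c d : ℝ} (hab : a ≤ b) (hcd : c ≤ d) (v w : H) :
    inner ℂ ((E.toFun b - E.toFun a) v) ((E.toFun d - E.toFun c) w)
      = inner ℂ v (E.toFun (max (max a c) (min b d)) w) - inner ℂ v (E.toFun (max a c) w) := by
  simp only [sub_apply, inner_sub_left, inner_sub_right, E.inner_left, E.apply_apply]
  rcases le_total b c with h | h
  · rw [min_eq_left (h.trans hcd), min_eq_left h, min_eq_left (hab.trans (h.trans hcd)),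
      min_eq_left (hab.trans h), max_eq_right (hab.trans h), max_eq_left h]
    ring
  rcases le_total d a with h' | h'
  · rw [min_eq_right (h'.trans hab), min_eq_right h, min_eq_right h',
      min_eq_right (hcd.trans h'), max_eq_left (hcd.trans h'), max_eq_left h']
    ring
  rw [max_eq_right (max_le (le_min hab h') (le_min h hcd)), min_eq_right h, min_eq_left h']
  rcases le_total a c with h'' | h''
  · rw [min_eq_left h'', max_eq_right h'']
    ring
  · rw [min_eq_right h'', max_eq_left h'']
    ring

theorem inner_increments_eq_measure {a b c d : ℝ} (hab : a ≤ b) (hcd : c ≤ d) (v : H) :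
    inner ℂ ((E.toFun b - E.toFun a) v) ((E.toFun d - E.toFun c) v)
      = (((E.distribution v).measure.real (Ioc a b ∩ Ioc c d) : ℝ) : ℂ) := by
  rw [E.inner_increments hab hcd, Ioc_inter_Ioc, measureReal_def, StieltjesFunction.measure_Ioc,
    ← ofReal_distribution, ← ofReal_distribution, ← Complex.ofReal_sub]
  congr 1
  change _ = (ENNReal.ofReal (_ - E.distribution v (max a c))).toReal
  rcases le_total (max a c) (min b d) with h | h
  · rw [max_eq_right h, ENNReal.toReal_ofReal (sub_nonneg.2 ((E.distribution v).mono h))]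
  · rw [max_eq_left h, ENNReal.ofReal_of_nonpos (sub_nonpos.2 ((E.distribution v).mono h))]
    simp

/-- Increments over non-overlapping cells of a partition are orthogonal; over the same cell they
multiply as projections. -/
theorem inner_partition_increments (P : TaggedPartition) {j k : ℕ} (hj : j < P.n) (hk : k < P.n)
    (v w : H) :
    inner ℂ ((E.toFun (P.pt (j + 1)) - E.toFun (P.pt j)) v)
        ((E.toFun (P.pt (k + 1)) - E.toFun (P.pt k)) w)
      = if j = k then inner ℂ v ((E.toFun (P.pt (k + 1)) - E.toFun (P.pt k)) w) else 0 := by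
  have hcell : ∀ k < P.n, P.pt k ≤ P.pt (k + 1) := fun k hk =>
    (P.tag_mem k hk).1.trans (P.tag_mem k hk).2
  have hmono : ∀ i m, i + m ≤ P.n → P.pt i ≤ P.pt (i + m) := by
    intro i m
    induction m with
    | zero => simp
    | succ m ih => exact fun h => (ih (by lia)).trans (hcell (i + m) (by lia))
  rw [E.inner_increments (hcell j hj) (hcell k hk)]
  have := hcell j hj
  have := hcell k hk
  split_ifs with h
  · subst h
    simp [max_eq_right this]
  · rcases lt_or_gt_of_ne h with h | h
    · obtain ⟨m, rfl⟩ := Nat.exists_eq_add_of_le (Nat.succ_le_of_lt h)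
      have := hmono (j + 1) m (by lia)
      rw [max_eq_left, sub_self]
      exact (min_le_left _ _).trans (this.trans (le_max_right _ _))
    · obtain ⟨m, rfl⟩ := Nat.exists_eq_add_of_le (Nat.succ_le_of_lt h)
      have := hmono (k + 1) m (by lia)
      rw [max_eq_left, sub_self]
      exact (min_le_right _ _).trans (this.trans (le_max_left _ _))

/-! ### Step functions -/

/-- Pairs `(φ, ∫ dE φ w)` with a step function `φ`. -/
def stepPairs (w : H) : Submodule ℂ ((ℝ → ℂ) × H) :=
  Submodule.span ℂ {p | ∃ a b : ℝ, a ≤ b ∧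
    p = ((Ioc a b).indicator 1, (E.toFun b - E.toFun a) w)}

theorem indicator_mem_stepPairs (w : H) {a b : ℝ} (h : a ≤ b) :
    ((Ioc a b).indicator 1, (E.toFun b - E.toFun a) w) ∈ E.stepPairs w :=
  Submodule.subset_span ⟨a, b, h, rfl⟩

theorem memLp_of_mem_stepPairs {w : H} {p : (ℝ → ℂ) × H} (hp : p ∈ E.stepPairs w) :
    MemLp p.1 2 (E.distribution w).measure := by
  induction hp using Submodule.span_induction with
  | mem p hp =>
    obtain ⟨a, b, -, rfl⟩ := hp
    exact memLp_indicator_const 2 measurableSet_Ioc (1 : ℂ) (Or.inr (measure_ne_top _ _))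
  | zero => exact MemLp.zero
  | add p q _ _ hp hq => exact hp.add hq
  | smul c p _ hp => exact hp.const_smul c

/-- The isometry on step functions, extended from indicators by sesquilinearity. Carrying the vector
along with the function makes it unnecessary to show beforehand that the vector is independent of
how the step function is written. -/
theorem inner_of_mem_stepPairs {w : H} {p q : (ℝ → ℂ) × H} (hp : p ∈ E.stepPairs w)
    (hq : q ∈ E.stepPairs w) :
    inner ℂ p.2 q.2 = ∫ x, inner ℂ (p.1 x) (q.1 x) ∂(E.distribution w).measure := by
  have hint : ∀ {p q}, p ∈ E.stepPairs w → q ∈ E.stepPairs w →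
      Integrable (fun x => inner ℂ (p.1 x) (q.1 x)) (E.distribution w).measure := by
    intro p q hp hq
    exact (E.memLp_of_mem_stepPairs hq).integrable_mul (E.memLp_of_mem_stepPairs hp).star
  induction hp, hq using Submodule.span_induction₂ with
  | mem_mem p q hp hq =>
    obtain ⟨a, b, hab, rfl⟩ := hp
    obtain ⟨c, d, hcd, rfl⟩ := hq
    rw [E.inner_increments_eq_measure hab hcd]
    have : ∀ x, inner ℂ ((Ioc a b).indicator (1 : ℝ → ℂ) x) ((Ioc c d).indicator (1 : ℝ → ℂ) x)
        = (Ioc a b ∩ Ioc c d).indicator (1 : ℝ → ℂ) x := by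
      intro x
      by_cases h1 : x ∈ Ioc a b <;> by_cases h2 : x ∈ Ioc c d <;>
        simp only [indicator, mem_inter_iff, h1, h2] <;> simp
    simp only [this]
    rw [integral_indicator (measurableSet_Ioc.inter measurableSet_Ioc)]
    simp
  | zero_left => simp
  | zero_right => simp
  | add_left x y z hx hy hz h1 h2 =>
    simp only [Prod.snd_add, Prod.fst_add, Pi.add_apply, inner_add_left, h1, h2]
    rw [integral_add (hint hx hz) (hint hy hz)]
  | add_right x y z hx hy hz h1 h2 =>
    simp only [Prod.snd_add, Prod.fst_add, Pi.add_apply, inner_add_right, h1, h2]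
    rw [integral_add (hint hx hy) (hint hx hz)]
  | smul_left c x y hx hy h =>
    simp only [Prod.smul_snd, Prod.smul_fst, Pi.smul_apply, inner_smul_left, h]
    rw [integral_const_mul]
  | smul_right c x y hx hy h =>
    simp only [Prod.smul_snd, Prod.smul_fst, Pi.smul_apply, inner_smul_right, h]
    rw [integral_const_mul]

theorem norm_sq_of_mem_stepPairs {w : H} {p : (ℝ → ℂ) × H} (hp : p ∈ E.stepPairs w) :
    ‖p.2‖ ^ 2 = ∫ x, ‖p.1 x‖ ^ 2 ∂(E.distribution w).measure := by
  have h := E.inner_of_mem_stepPairs hp hp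
  simp only [inner_self_eq_norm_sq_to_K, Complex.coe_algebraMap, ← Complex.ofReal_pow] at h
  rw [integral_complex_ofReal] at h
  exact_mod_cast h

/-- The sup norm controls the `L²` norm because the spectral measure of `w` has mass `‖w‖²`. -/
theorem norm_le_of_mem_stepPairs {w : H} {p : (ℝ → ℂ) × H} (hp : p ∈ E.stepPairs w) {η : ℝ}
    (hη : 0 ≤ η) (h : ∀ x, ‖p.1 x‖ ≤ η) : ‖p.2‖ ≤ η * ‖w‖ := by
  refine (sq_le_sq₀ (norm_nonneg _) (by positivity)).1 ?_
  rw [E.norm_sq_of_mem_stepPairs hp, mul_pow, ← E.measureReal_distribution_univ, mul_comm,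
    ← smul_eq_mul, ← integral_const]
  refine integral_mono_of_nonneg (Eventually.of_forall fun x => by positivity)
    (integrable_const _) (Eventually.of_forall fun x => ?_)
  exact pow_le_pow_left₀ (norm_nonneg _) (h x) 2

end ResolutionOfIdentity

/-- The step function taking the value `φ (tag k)` on the `k`-th cell. -/
def TaggedPartition.step (P : TaggedPartition) (φ : ℝ → ℂ) : ℝ → ℂ :=
  ∑ k ∈ Finset.range P.n, φ (P.tag k) • (Ioc (P.pt k) (P.pt (k + 1))).indicator 1

theorem ResolutionOfIdentity.step_mem_stepPairs {H : Type*} [NormedAddCommGroup H]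
    [InnerProductSpace ℂ H] [CompleteSpace H] (E : ResolutionOfIdentity H) (w : H)
    (P : TaggedPartition) (φ : ℝ → ℂ) :
    (P.step φ, stieltjesSum E.toFun (fun x => φ x • w) P) ∈ E.stepPairs w := by
  have h : (P.step φ, stieltjesSum E.toFun (fun x => φ x • w) P) = ∑ k ∈ Finset.range P.n,
      φ (P.tag k) • (((Ioc (P.pt k) (P.pt (k + 1))).indicator 1,
        (E.toFun (P.pt (k + 1)) - E.toFun (P.pt k)) w) : (ℝ → ℂ) × H) := by
    ext1
    · simp only [Prod.fst_sum, Prod.smul_fst, TaggedPartition.step]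
    · simp only [Prod.snd_sum, Prod.smul_snd, stieltjesSum, map_smul]
  rw [h]
  refine Submodule.sum_mem _ fun k hk => Submodule.smul_mem _ _ (E.indicator_mem_stepPairs w ?_)
  have hk := P.tag_mem k (Finset.mem_range.1 hk)
  exact hk.1.trans hk.2

theorem TaggedPartition.step_apply (P : TaggedPartition) (φ : ℝ → ℂ) (x : ℝ) :
    (P.step φ x = 0 ∧ x ∉ Ioc (P.pt 0) (P.pt P.n)) ∨
      ∃ k < P.n, x ∈ Ioc (P.pt k) (P.pt (k + 1)) ∧ P.step φ x = φ (P.tag k) := by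
  -- Induction on the number of cells. The conjunct `x ≤ P.pt m` ensures that a point already
  -- covered lies outside the next cell, which is open on the left, so at most one indicator
  -- contributes.
  have key : ∀ m ≤ P.n, P.pt 0 ≤ P.pt m ∧
      (((∑ k ∈ Finset.range m, φ (P.tag k) • (Ioc (P.pt k) (P.pt (k + 1))).indicator 1 : ℝ → ℂ) x
        = 0 ∧ x ∉ Ioc (P.pt 0) (P.pt m)) ∨
      ∃ k < m, x ∈ Ioc (P.pt k) (P.pt (k + 1)) ∧ x ≤ P.pt m ∧
        (∑ k ∈ Finset.range m, φ (P.tag k) • (Ioc (P.pt k) (P.pt (k + 1))).indicator 1 : ℝ → ℂ) x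
          = φ (P.tag k)) := by
    intro m
    induction m with
    | zero => simp
    | succ m ih =>
      intro hm
      obtain ⟨h0, ih⟩ := ih (by lia)
      have hc : P.pt m ≤ P.pt (m + 1) := (P.tag_mem m hm).1.trans (P.tag_mem m hm).2
      refine ⟨h0.trans hc, ?_⟩
      simp only [Finset.sum_range_succ, Pi.add_apply, Pi.smul_apply]
      rcases ih with ⟨h1, h2⟩ | ⟨k, hk, hxk, hxm, hs⟩
      · by_cases hx : x ∈ Ioc (P.pt m) (P.pt (m + 1))
        · exact Or.inr ⟨m, by lia, hx, hx.2, by simp [h1, hx]⟩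
        · refine Or.inl ⟨by simp [h1, hx], fun h => ?_⟩
          rcases le_or_gt x (P.pt m) with h' | h'
          · exact h2 ⟨h.1, h'⟩
          · exact hx ⟨h', h.2⟩
      · have hx : x ∉ Ioc (P.pt m) (P.pt (m + 1)) := fun h => absurd h.1 (not_lt.2 hxm)
        exact Or.inr ⟨k, by lia, hxk, hxm.trans hc, by simp [hs, hx]⟩
  rcases (key P.n le_rfl).2 with h | ⟨k, hk, h1, -, h2⟩
  · exact Or.inl h
  · exact Or.inr ⟨k, hk, h1, h2⟩

theorem eventually_step_close {φ : ℝ → ℂ} (hφ : Continuous φ) (hc : HasCompactSupport φ)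
    {η : ℝ} (hη : 0 < η) : ∀ᶠ P in refining, ∀ x, ‖P.step φ x - φ x‖ ≤ η := by
  obtain ⟨R, hR0, hR⟩ : ∃ R : ℝ, 0 < R ∧ ∀ x, φ x ≠ 0 → |x| ≤ R := by
    obtain ⟨R, hR0, hR⟩ := hc.isCompact.isBounded.exists_pos_norm_le
    exact ⟨R, hR0, fun x hx => hR x (subset_tsupport _ hx)⟩
  obtain ⟨δ, hδ0, hδ⟩ := Metric.uniformContinuous_iff.1
    (hc.uniformContinuous_of_continuous hφ) η hη
  -- Fineness `δ` bounds the oscillation on each cell; fineness `R⁻¹` makes the partition extend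
  -- beyond `[-R, R]`, so off its interval both functions vanish.
  filter_upwards [eventually_isFine hδ0, eventually_isFine (inv_pos.2 hR0)] with P hP hP'
  intro x
  rcases P.step_apply φ x with ⟨h0, hx⟩ | ⟨k, hk, hx, hs⟩
  · have : φ x = 0 := by
      by_contra h
      have h1 := abs_le.1 (hR x h)
      have h2 := hP'.1
      have h3 := hP'.2.1
      rw [inv_inv] at h2 h3
      exact hx ⟨by linarith, by linarith⟩
    simp [h0, this, hη.le]
  · rw [hs, ← dist_eq_norm]
    refine (hδ ?_).le
    have h1 := P.tag_mem k hk
    have h2 := hP.2.2 k hk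
    rw [Real.dist_eq, abs_lt]
    constructor <;> linarith [hx.1, hx.2, h1.1, h1.2]

/-! ### Linearity of Stieltjes integrals -/

section Linearity

variable {X Y : Type*} [NormedAddCommGroup X] [InnerProductSpace ℂ X]
  [NormedAddCommGroup Y] [InnerProductSpace ℂ Y] {E : ℝ → X →L[ℂ] Y}

theorem HasStieltjesIntegral.unique {u : ℝ → X} {y z : Y} (h : HasStieltjesIntegral E u y)
    (h' : HasStieltjesIntegral E u z) : y = z :=
  tendsto_nhds_unique h h'

theorem HasStieltjesIntegral.add {u v : ℝ → X} {y z : Y} (h : HasStieltjesIntegral E u y)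
    (h' : HasStieltjesIntegral E v z) : HasStieltjesIntegral E (fun x => u x + v x) (y + z) := by
  refine (Tendsto.add h h').congr fun P => ?_
  simp only [stieltjesSum, map_add, Finset.sum_add_distrib]

theorem HasStieltjesIntegral.const_smul {u : ℝ → X} {y : Y} (c : ℂ)
    (h : HasStieltjesIntegral E u y) : HasStieltjesIntegral E (fun x => c • u x) (c • y) := by
  refine (Tendsto.const_smul h c).congr fun P => ?_
  simp only [stieltjesSum, map_smul, Finset.smul_sum]

theorem HasStieltjesIntegral.sum {ι : Type*} (s : Finset ι) {u : ι → ℝ → X} {y : ι → Y}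
    (h : ∀ i ∈ s, HasStieltjesIntegral E (u i) (y i)) :
    HasStieltjesIntegral E (fun x => ∑ i ∈ s, u i x) (∑ i ∈ s, y i) := by
  refine (tendsto_finsetSum s h).congr fun P => ?_
  simp only [stieltjesSum, map_sum]
  exact Finset.sum_comm

end Linearity

/-! ### Stieltjes integrals of continuous compactly supported functions -/

namespace ResolutionOfIdentity

variable {H : Type*} [NormedAddCommGroup H] [InnerProductSpace ℂ H] [CompleteSpace H]
  (E : ResolutionOfIdentity H)

/-- Cauchy criterion without a common refinement: the difference of two Riemann sums is itself the
integral of a step function, uniformly small since both step functions are close to `φ`. -/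
theorem exists_hasStieltjesIntegral_smul {φ : ℝ → ℂ} (hφ : Continuous φ) (hc : HasCompactSupport φ)
    (w : H) : ∃ y, HasStieltjesIntegral E.toFun (fun x => φ x • w) y := by
  refine cauchy_map_iff_exists_tendsto.1 (Metric.cauchy_iff.2 ⟨inferInstance, fun ε hε => ?_⟩)
  set η : ℝ := ε / (4 * (‖w‖ + 1)) with hη
  have hη0 : 0 < η := by positivity
  refine ⟨_, image_mem_map (eventually_step_close hφ hc hη0), ?_⟩
  rintro _ ⟨P, hP, rfl⟩ _ ⟨P', hP', rfl⟩
  have h := E.norm_le_of_mem_stepPairs (sub_mem (E.step_mem_stepPairs w P φ)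
    (E.step_mem_stepPairs w P' φ)) (η := 2 * η) (by positivity) fun x => ?_
  · rw [dist_eq_norm]
    refine h.trans_lt ?_
    rw [hη]
    have : 2 * (ε / (4 * (‖w‖ + 1))) * ‖w‖ = ε * (‖w‖ / (2 * (‖w‖ + 1))) := by
      field_simp
      ring
    rw [this]
    refine mul_lt_of_lt_one_right hε ?_
    rw [div_lt_one (by positivity)]
    linarith [norm_nonneg w]
  · have h1 := hP x
    have h2 := hP' x
    calc ‖P.step φ x - P'.step φ x‖ = ‖(P.step φ x - φ x) - (P'.step φ x - φ x)‖ := by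
          congr 1; ring
      _ ≤ η + η := (norm_sub_le _ _).trans (add_le_add h1 h2)
      _ = 2 * η := by ring

/-- A crude form of the isometry between a step function and a continuous one. The factor 2 comes
from `(s + η)² ≤ 2s² + 2η²` and is harmless for density arguments. -/
theorem norm_sub_sq_le_of_mem_stepPairs {φ : ℝ → ℂ} (hφ : Continuous φ)
    (hc : HasCompactSupport φ) {w y : H}
    (hy : HasStieltjesIntegral E.toFun (fun x => φ x • w) y) {p : (ℝ → ℂ) × H}
    (hp : p ∈ E.stepPairs w) :
    ‖p.2 - y‖ ^ 2 ≤ 2 * ∫ x, ‖p.1 x - φ x‖ ^ 2 ∂(E.distribution w).measure := by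
  set I := ∫ x, ‖p.1 x - φ x‖ ^ 2 ∂(E.distribution w).measure
  have hφL : MemLp φ 2 (E.distribution w).measure := hφ.memLp_of_hasCompactSupport hc
  have hint : Integrable (fun x => ‖p.1 x - φ x‖ ^ 2) (E.distribution w).measure :=
    ((E.memLp_of_mem_stepPairs hp).sub hφL).integrable_norm_pow (by norm_num)
  have key : ∀ η : ℝ, 0 < η → ‖p.2 - y‖ ^ 2 ≤ 2 * I + 2 * η ^ 2 * ‖w‖ ^ 2 := by
    intro η hη
    refine le_of_tendsto ((tendsto_const_nhds.sub hy).norm.pow 2) ?_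
    filter_upwards [eventually_step_close hφ hc hη] with P hP
    have h := E.norm_sq_of_mem_stepPairs (sub_mem hp (E.step_mem_stepPairs w P φ))
    refine h.le.trans ?_
    have hr : 2 * I + 2 * η ^ 2 * ‖w‖ ^ 2
        = ∫ x, (2 * ‖p.1 x - φ x‖ ^ 2 + 2 * η ^ 2) ∂(E.distribution w).measure := by
      rw [integral_add (hint.const_mul 2) (integrable_const _), integral_const_mul, integral_const,
        measureReal_distribution_univ, smul_eq_mul]
      ring
    rw [hr]
    refine integral_mono_of_nonneg (Eventually.of_forall fun x => by positivity)
      ((hint.const_mul 2).add (integrable_const _)) (Eventually.of_forall fun x => ?_)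
    have h1 : ‖p.1 x - P.step φ x‖ ≤ ‖p.1 x - φ x‖ + η := by
      calc ‖p.1 x - P.step φ x‖ = ‖(p.1 x - φ x) - (P.step φ x - φ x)‖ := by congr 1; ring
        _ ≤ _ := (norm_sub_le _ _).trans (by gcongr; exact hP x)
    calc ‖p.1 x - P.step φ x‖ ^ 2 ≤ (‖p.1 x - φ x‖ + η) ^ 2 := by gcongr
      _ ≤ 2 * ‖p.1 x - φ x‖ ^ 2 + 2 * η ^ 2 := by
        nlinarith [sq_nonneg (‖p.1 x - φ x‖ - η)]
  have hlim : Tendsto (fun η : ℝ => 2 * I + 2 * η ^ 2 * ‖w‖ ^ 2) (𝓝[>] 0) (𝓝 (2 * I)) := by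
    have : Continuous fun η : ℝ => 2 * I + 2 * η ^ 2 * ‖w‖ ^ 2 := by fun_prop
    simpa using (this.tendsto 0).mono_left nhdsWithin_le_nhds
  exact ge_of_tendsto hlim (eventually_nhdsWithin_of_forall key)

/-- Orthogonality of the cells collapses the double sum to its diagonal. The identity holds for each
partition before any limit, so it serves both the isometry and the pairing with `T`. -/
theorem inner_stieltjesSum (u v : ℝ → H) (P : TaggedPartition) :
    inner ℂ (stieltjesSum E.toFun u P) (stieltjesSum E.toFun v P) = formSum E.toFun u v P := by
  simp only [stieltjesSum, formSum, sum_inner, inner_sum]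
  refine Finset.sum_congr rfl fun j hj => ?_
  rw [Finset.sum_congr rfl fun k hk => E.inner_partition_increments P (Finset.mem_range.1 hk)
    (Finset.mem_range.1 hj) _ _]
  rw [Finset.sum_ite_eq', if_pos hj]

variable {N : Type*} [NormedAddCommGroup N] [InnerProductSpace ℂ N]

/-- Expanding `f` in an orthonormal basis of the finite-dimensional space containing its values
leaves finitely many scalar integrands. -/
theorem exists_hasStieltjesIntegral (A : N →L[ℂ] H) (f : simpleCc N) :
    ∃ y, HasStieltjesIntegral E.toFun (fun x => A (f.1 x)) y := by
  obtain ⟨hfc, hfs, W, hW, hfW⟩ := f.2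
  let e := stdOrthonormalBasis ℂ W
  have hfe : ∀ x, A (f.1 x) = ∑ i, inner ℂ (e i : N) (f.1 x) • A (e i : N) := fun x => by
    have := congrArg (fun z : W => A z) (e.sum_repr' ⟨f.1 x, hfW x⟩)
    simpa using this.symm
  have hex : ∀ i, ∃ y, HasStieltjesIntegral E.toFun
      (fun x => inner ℂ (e i : N) (f.1 x) • A (e i : N)) y := by
    intro i
    refine E.exists_hasStieltjesIntegral_smul (φ := fun x => inner ℂ (e i : N) (f.1 x))
      (by fun_prop) (hfs.mono fun x hx => ?_) _
    rw [Function.mem_support] at hx ⊢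
    intro h0
    simp [h0] at hx
  choose y hy using hex
  refine ⟨∑ i, y i, ?_⟩
  simp only [hfe]
  exact HasStieltjesIntegral.sum Finset.univ fun i _ => hy i

/-- The map `f ↦ ∫ dE_x A f(x)`. -/
def synthesis (A : N →L[ℂ] H) : simpleCc N →ₗ[ℂ] H where
  toFun f := (E.exists_hasStieltjesIntegral A f).choose
  map_add' f g := by
    refine (E.exists_hasStieltjesIntegral A (f + g)).choose_spec.unique ?_
    have h := (E.exists_hasStieltjesIntegral A f).choose_spec.add
      (E.exists_hasStieltjesIntegral A g).choose_spec
    simp only [← map_add] at h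
    exact h
  map_smul' c f := by
    refine (E.exists_hasStieltjesIntegral A (c • f)).choose_spec.unique ?_
    have h := (E.exists_hasStieltjesIntegral A f).choose_spec.const_smul c
    simp only [← map_smul] at h
    exact h

theorem hasStieltjesIntegral_synthesis (A : N →L[ℂ] H) (f : simpleCc N) :
    HasStieltjesIntegral E.toFun (fun x => A (f.1 x)) (E.synthesis A f) :=
  (E.exists_hasStieltjesIntegral A f).choose_spec

theorem increment_mem_closure_range_synthesis (A : N →L[ℂ] H) {a b : ℝ} (hab : a ≤ b) (n : N) :
    (E.toFun b - E.toFun a) (A n) ∈ (LinearMap.range (E.synthesis A)).topologicalClosure := by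
  refine Metric.mem_closure_iff.2 fun ε hε => ?_
  have hp := E.indicator_mem_stepPairs (A n) hab
  have hL := E.memLp_of_mem_stepPairs hp
  -- With the factor 2 of `norm_sub_sq_le_of_mem_stepPairs`, the error `ε² / 4` yields squared
  -- distance at most `ε² / 2 < ε²`.
  obtain ⟨φ, hc, hI, hφ, -⟩ := MemLp.exists_hasCompactSupport_integral_rpow_sub_le
    (p := 2) two_pos (by simpa using hL) (ε := ε ^ 2 / 4) (by positivity)
  let f : simpleCc N := ⟨fun x => φ x • n, by fun_prop, hc.smul_right (f' := fun _ => n),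
    Submodule.span ℂ {n}, inferInstance,
    fun x => Submodule.smul_mem _ _ (Submodule.mem_span_singleton_self n)⟩
  refine ⟨E.synthesis A f, ⟨f, rfl⟩, ?_⟩
  have hf := E.hasStieltjesIntegral_synthesis A f
  simp only [f, map_smul] at hf
  have h := E.norm_sub_sq_le_of_mem_stepPairs hφ hc hf hp
  simp only [Real.rpow_two] at hI
  rw [dist_eq_norm]
  refine lt_of_pow_lt_pow_left₀ 2 hε.le (h.trans_lt ?_)
  have : 0 < ε ^ 2 := by positivity
  linarith

/-! ### Isometry and dense range of the synthesis map. -/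

variable [CompleteSpace N]

theorem formSum_compress (ψ : H →L[ℂ] N) (f g : ℝ → N) (P : TaggedPartition) :
    formSum (E.compress ψ).toFun f g P = formSum E.toFun
      (fun x => ContinuousLinearMap.adjoint ψ (f x))
      (fun x => ContinuousLinearMap.adjoint ψ (g x)) P := by
  refine Finset.sum_congr rfl fun k _ => ?_
  simp only [compress, sub_apply, ContinuousLinearMap.comp_apply, inner_sub_right,
    ContinuousLinearMap.adjoint_inner_left]

theorem inner_synthesis (ψ : H →L[ℂ] N) (f g : simpleCc N) :
    inner ℂ (E.synthesis (ContinuousLinearMap.adjoint ψ) f)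
        (E.synthesis (ContinuousLinearMap.adjoint ψ) g)
      = inner ℂ (L2.mk (E.compress ψ) f) (L2.mk (E.compress ψ) g) := by
  rw [L2.inner_mk]
  refine tendsto_nhds_unique ?_ ((E.compress ψ).tendsto_formSum f.2 g.2)
  refine (Tendsto.inner (E.hasStieltjesIntegral_synthesis (ContinuousLinearMap.adjoint ψ) f)
    (E.hasStieltjesIntegral_synthesis (ContinuousLinearMap.adjoint ψ) g)).congr fun P => ?_
  rw [E.inner_stieltjesSum, E.formSum_compress]

theorem norm_synthesis (ψ : H →L[ℂ] N) (f : simpleCc N) :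
    ‖E.synthesis (ContinuousLinearMap.adjoint ψ) f‖ = ‖L2.mk (E.compress ψ) f‖ := by
  rw [@norm_eq_sqrt_re_inner ℂ, @norm_eq_sqrt_re_inner ℂ, E.inner_synthesis]

theorem denseRange_synthesis {G : Submodule ℂ H} (hG : E.IsGenerating G) (ψ : H →L[ℂ] N)
    (hker : LinearMap.ker (ψ : H →ₗ[ℂ] N) ≤ Gᗮ) :
    DenseRange (E.synthesis (ContinuousLinearMap.adjoint ψ)) := by
  -- `G ≤ Gᗮᗮ ≤ (ker ψ)ᗮ`, and the last space is the closure of the range of `ψ*`.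
  have hGr : ∀ g ∈ G, g ∈ (ContinuousLinearMap.adjoint ψ).range.topologicalClosure := by
    intro g hg
    rw [← ContinuousLinearMap.orthogonal_ker]
    exact Submodule.orthogonal_le hker (Submodule.le_orthogonal_orthogonal G hg)
  set R := (LinearMap.range (E.synthesis (ContinuousLinearMap.adjoint ψ))).topologicalClosure
    with hR
  have hRtop : R = ⊤ := by
    rw [eq_top_iff, ← hG]
    refine Submodule.topologicalClosure_minimal _ (Submodule.span_le.2 ?_)
      (Submodule.isClosed_topologicalClosure _)
    rintro _ ⟨a, b, hab, g, hg, rfl⟩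
    -- Since `E_Δ` is continuous, it suffices to treat vectors `ψ* n` instead of their limits `g`.
    refine closure_minimal (t := (E.toFun b - E.toFun a) ⁻¹' (R : Set H)) ?_
      ((Submodule.isClosed_topologicalClosure _).preimage (ContinuousLinearMap.continuous _))
      (hGr g hg)
    rintro _ ⟨n, rfl⟩
    exact E.increment_mem_closure_range_synthesis _ hab n
  exact Submodule.dense_iff_topologicalClosure_eq_top.2 hRtop

/-! ### The operator `T` on the range of the synthesis map -/

/-- The linear isometry of `L²_ℝ(N, dF)` onto `H` extending the synthesis map. -/
def synthesisEquiv {G : Submodule ℂ H} (hG : E.IsGenerating G) (ψ : H →L[ℂ] N)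
    (hker : LinearMap.ker (ψ : H →ₗ[ℂ] N) ≤ Gᗮ) : L2 (E.compress ψ) ≃ₗᵢ[ℂ] H :=
  (LinearEquiv.refl ℂ (simpleCc N)).extendOfIsometry (L2.mk (E.compress ψ))
    (E.synthesis (ContinuousLinearMap.adjoint ψ)) (L2.denseRange_mk _)
    (E.denseRange_synthesis hG ψ hker) (E.norm_synthesis ψ)

theorem synthesisEquiv_mk {G : Submodule ℂ H} (hG : E.IsGenerating G) (ψ : H →L[ℂ] N)
    (hker : LinearMap.ker (ψ : H →ₗ[ℂ] N) ≤ Gᗮ) (f : simpleCc N) :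
    E.synthesisEquiv hG ψ hker (L2.mk (E.compress ψ) f)
      = E.synthesis (ContinuousLinearMap.adjoint ψ) f :=
  LinearEquiv.extendOfIsometry_eq _ _ _ _ _ _ _

end ResolutionOfIdentity

/-! ### Weak description of the graph of a self-adjoint operator. -/

theorem _root_.IsSelfAdjoint.mem_graph_iff {H : Type*} [NormedAddCommGroup H]
    [InnerProductSpace ℂ H] [CompleteSpace H] {T : H →ₗ.[ℂ] H} (hT : IsSelfAdjoint T) {v w : H} :
    (v, w) ∈ T.graph ↔ ∀ a b, (a, b) ∈ T.graph → inner ℂ b v = inner ℂ a w := by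
  have h := LinearPMap.adjoint_graph_eq_graph_adjoint hT.dense_domain
  rw [LinearPMap.isSelfAdjoint_def.1 hT] at h
  conv_lhs => rw [h]
  simp only [Submodule.mem_adjoint_iff, sub_eq_zero]

namespace ResolutionOfIdentity

variable {H : Type*} [NormedAddCommGroup H] [InnerProductSpace ℂ H] [CompleteSpace H]
  {E : ResolutionOfIdentity H}
  {N : Type*} [NormedAddCommGroup N] [InnerProductSpace ℂ N]

/-- Self-adjointness allows a weak test against pairs `(a, b)` in the graph, where `b = ∫ x dE a`.
At each partition the collapsed sums agree, since the real factor `x` moves freely across the inner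
product. No convergence of `∫ x dE` at the synthesized vector has to be proved directly. -/
theorem IsResolutionOf.synthesis_mem_graph {T : H →ₗ.[ℂ] H} (hE : E.IsResolutionOf T)
    (hT : IsSelfAdjoint T) (A : N →L[ℂ] H) (g : simpleCc N) :
    (E.synthesis A g, E.synthesis A (mulVar g)) ∈ T.graph := by
  refine hT.mem_graph_iff.2 fun a b hab => ?_
  have h1 := Tendsto.inner (𝕜 := ℂ) ((hE a b).1 hab) (E.hasStieltjesIntegral_synthesis A g)
  have h2 := Tendsto.inner (𝕜 := ℂ) (tendsto_const_nhds (x := a))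
    (E.hasStieltjesIntegral_synthesis A (mulVar g))
  refine tendsto_nhds_unique h1 (h2.congr fun P => ?_)
  rw [E.inner_stieltjesSum]
  simp only [stieltjesSum, formSum, inner_sum, mulVar]
  refine Finset.sum_congr rfl fun k _ => ?_
  simp only [map_smul, inner_smul_left, inner_smul_right, Complex.conj_ofReal]

end ResolutionOfIdentity

/-! ### Synthesized vectors form a core of `T`. -/

/-- The function `x ↦ (x + i)⁻¹ f(x)`. -/
def resolventMul {N : Type*} [NormedAddCommGroup N] [InnerProductSpace ℂ N] (f : simpleCc N) :
    simpleCc N :=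
  ⟨fun x => ((x : ℂ) + Complex.I)⁻¹ • f.1 x, by
    obtain ⟨hf, hf', W, hW, hfW⟩ := f.2
    refine ⟨Continuous.smul (Continuous.inv₀ (by fun_prop) fun x h => ?_) hf,
      hf'.smul_left (f := fun x : ℝ => ((x : ℂ) + Complex.I)⁻¹), W, hW,
      fun x => W.smul_mem _ (hfW x)⟩
    simpa using congrArg Complex.im h⟩

/-- This is `x / (x + i) = 1 - i / (x + i)`. It makes every synthesized vector the image under `T +
i` of another one. -/
theorem mulVar_resolventMul {N : Type*} [NormedAddCommGroup N] [InnerProductSpace ℂ N]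
    (f : simpleCc N) : mulVar (resolventMul f) = f - Complex.I • resolventMul f := by
  refine Subtype.ext (funext fun x => ?_)
  have hx : (x : ℂ) + Complex.I ≠ 0 := fun h => by simpa using congrArg Complex.im h
  change (x : ℂ) • ((x : ℂ) + Complex.I)⁻¹ • f.1 x
    = f.1 x - Complex.I • ((x : ℂ) + Complex.I)⁻¹ • f.1 x
  rw [eq_sub_iff_add_eq, smul_smul, smul_smul, ← add_smul, ← add_mul, mul_inv_cancel₀ hx, one_smul]

/-- The cross term is the real part of `i⟪w, v⟫`, and `⟪w, v⟫` is real by symmetry. So approximation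
of `(T + i)v` is approximation in graph norm. -/
theorem _root_.IsSelfAdjoint.norm_sq_add_I_smul {H : Type*} [NormedAddCommGroup H]
    [InnerProductSpace ℂ H] [CompleteSpace H] {T : H →ₗ.[ℂ] H} (hT : IsSelfAdjoint T) {v w : H}
    (h : (v, w) ∈ T.graph) : ‖w + Complex.I • v‖ ^ 2 = ‖w‖ ^ 2 + ‖v‖ ^ 2 := by
  have h1 : inner ℂ w v = inner ℂ v w := hT.mem_graph_iff.1 h v w h
  have h2 : (inner ℂ w v).im = 0 := Complex.conj_eq_iff_im.1 (by rw [inner_conj_symm, h1])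
  rw [@norm_add_sq ℂ, inner_smul_right, norm_smul]
  simp [h2]

namespace ResolutionOfIdentity

variable {H : Type*} [NormedAddCommGroup H] [InnerProductSpace ℂ H] [CompleteSpace H]
  {E : ResolutionOfIdentity H}
  {N : Type*} [NormedAddCommGroup N] [InnerProductSpace ℂ N]

/-- The range of the synthesis map is a core of `T`. -/
theorem IsResolutionOf.mem_closure_synthesis_graph {T : H →ₗ.[ℂ] H} (hE : E.IsResolutionOf T)
    (hT : IsSelfAdjoint T) {A : N →L[ℂ] H} (hA : DenseRange (E.synthesis A)) {v w : H}
    (h : (v, w) ∈ T.graph) :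
    (v, w) ∈ closure (range fun g : simpleCc N => (E.synthesis A g, E.synthesis A (mulVar g))) := by
  refine Metric.mem_closure_iff.2 fun ε hε => ?_
  -- Approximate `(T + i)v` by a synthesized vector and divide by `x + i`; the norm identity then
  -- bounds the errors in `v` and in `Tv` simultaneously.
  obtain ⟨f, hf⟩ := Metric.denseRange_iff.1 hA (w + Complex.I • v) ε hε
  refine ⟨_, ⟨resolventMul f, rfl⟩, ?_⟩
  set g := resolventMul f
  have h1 := T.graph.sub_mem h (hE.synthesis_mem_graph hT A g)
  have h2 := hT.norm_sq_add_I_smul (v := v - E.synthesis A g)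
    (w := w - E.synthesis A (mulVar g)) h1
  have h3 : w - E.synthesis A (mulVar g) + Complex.I • (v - E.synthesis A g)
      = w + Complex.I • v - E.synthesis A f := by
    rw [mulVar_resolventMul, map_sub, map_smul, smul_sub]
    abel
  rw [h3] at h2
  rw [dist_eq_norm] at hf
  rw [Prod.dist_eq, dist_eq_norm, dist_eq_norm, max_lt_iff]
  constructor
  · refine lt_of_le_of_lt (le_of_sq_le_sq ?_ (norm_nonneg _)) hf
    rw [h2]
    exact le_add_of_nonneg_left (by positivity)
  · refine lt_of_le_of_lt (le_of_sq_le_sq ?_ (norm_nonneg _)) hf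
    rw [h2]
    exact le_add_of_nonneg_right (by positivity)

variable [CompleteSpace N]

/-- Transported by `V`, the weak definition of `x f(x)` is the adjoint relation for `(V f, V h)`,
tested only on synthesized pairs. The relation is closed and those pairs are dense in the graph of
`T`, so it holds on the whole graph, which by self-adjointness means membership in it. -/
theorem IsResolutionOf.isMulVar_iff {T : H →ₗ.[ℂ] H} (hE : E.IsResolutionOf T)
    (hT : IsSelfAdjoint T) {G : Submodule ℂ H} (hG : E.IsGenerating G) (ψ : H →L[ℂ] N)
    (hker : LinearMap.ker (ψ : H →ₗ[ℂ] N) ≤ Gᗮ) (f h : L2 (E.compress ψ)) :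
    L2.IsMulVar (E.compress ψ) f h ↔
      (E.synthesisEquiv hG ψ hker f, E.synthesisEquiv hG ψ hker h) ∈ T.graph := by
  set V := E.synthesisEquiv hG ψ hker
  set A := ContinuousLinearMap.adjoint ψ
  have hV : ∀ g k, inner ℂ (L2.mk (E.compress ψ) g) k = inner ℂ (E.synthesis A g) (V k) := by
    intro g k
    rw [← E.synthesisEquiv_mk hG ψ hker, LinearIsometryEquiv.inner_map_map]
  have hiff : L2.IsMulVar (E.compress ψ) f h ↔ ∀ g : simpleCc N,
      inner ℂ (E.synthesis A (mulVar g)) (V f) = inner ℂ (E.synthesis A g) (V h) := by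
    simp only [L2.IsMulVar, hV, eq_comm]
  rw [hiff, hT.mem_graph_iff]
  refine ⟨fun H a b hab => ?_, fun H g => H _ _ (hE.synthesis_mem_graph hT A g)⟩
  have hcl : IsClosed {p : _ × _ | inner ℂ p.2 (V f) = inner ℂ p.1 (V h)} :=
    isClosed_eq (by fun_prop) (by fun_prop)
  refine closure_minimal ?_ hcl
    (hE.mem_closure_synthesis_graph hT (E.denseRange_synthesis hG ψ hker) hab)
  rintro _ ⟨g, rfl⟩
  exact H g

end ResolutionOfIdentity

end SpectralModel
end

/-! ### The main theorem. -/

theorem theorem2p1 {H 𝔑 : Type*} [NormedAddCommGroup H] [InnerProductSpace ℂ H] [CompleteSpace H]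
    [TopologicalSpace.SeparableSpace H]
    [NormedAddCommGroup 𝔑] [InnerProductSpace ℂ 𝔑] [CompleteSpace 𝔑]
    (T : H →ₗ.[ℂ] H) (hT : IsSelfAdjoint T)
    (E : ResolutionOfIdentity H) (hE : E.IsResolutionOf T)
    (G : Submodule ℂ H) (hG : E.IsGenerating G)
    (ψ : H →L[ℂ] 𝔑) (hker : LinearMap.ker (ψ : H →ₗ[ℂ] 𝔑) = Gᗮ)
    (hψ : Function.Injective (ContinuousLinearMap.adjoint ψ)) :
    ∃ V : L2 (E.compress ψ) ≃ₗᵢ[ℂ] H,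
      (∀ f : simpleCc 𝔑, HasStieltjesIntegral E.toFun
        (fun x => ContinuousLinearMap.adjoint ψ (f.1 x)) (V (L2.mk (E.compress ψ) f))) ∧
      (∀ W : L2 (E.compress ψ) →L[ℂ] H,
        (∀ f : simpleCc 𝔑, HasStieltjesIntegral E.toFun
          (fun x => ContinuousLinearMap.adjoint ψ (f.1 x)) (W (L2.mk (E.compress ψ) f))) →
        ∀ f, W f = V f) ∧
      (∀ f : L2 (E.compress ψ), f ∈ (mulOperator (E.compress ψ)).domain ↔ V f ∈ T.domain) ∧
      (∀ (f : (mulOperator (E.compress ψ)).domain) (hf : V f ∈ T.domain),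
        V (mulOperator (E.compress ψ) f) = T ⟨V f, hf⟩) := by
  have hker' := hker.le
  have hmul := hE.isMulVar_iff hT hG ψ hker'
  refine ⟨E.synthesisEquiv hG ψ hker', fun f => ?_, fun W hW f => ?_, fun f => ?_, fun f hf => ?_⟩
  · rw [E.synthesisEquiv_mk]
    exact E.hasStieltjesIntegral_synthesis _ f
  · refine congrFun ((L2.denseRange_mk (E.compress ψ)).equalizer W.continuous
      (E.synthesisEquiv hG ψ hker').continuous (funext fun g => ?_)) f
    refine (hW g).unique ?_
    simp only [Function.comp, E.synthesisEquiv_mk]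
    exact E.hasStieltjesIntegral_synthesis _ g
  · rw [mem_mulOperator_domain, LinearPMap.mem_domain_iff]
    refine ⟨fun ⟨h, hh⟩ => ⟨_, (hmul f h).1 hh⟩, fun ⟨w, hw⟩ => ?_⟩
    -- Surjectivity of `V` supplies the candidate for `Q f`, namely the preimage of `T V f`.
    refine ⟨(E.synthesisEquiv hG ψ hker').symm w, (hmul _ _).2 ?_⟩
    rwa [LinearIsometryEquiv.apply_symm_apply]
  · have h := (hmul _ _).1 (isMulVar_mulOperator f)
    obtain ⟨y, hy, hy'⟩ := (T.mem_graph_iff).1 h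
    have : y = ⟨_, hf⟩ := Subtype.ext hy
    exact hy'.symm.trans (congrArg T this)
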